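/- Consider $n \ge 3$ nodes and $k$ mobile agents with distinct identifiers. In each round $r = 0, 1, 2, \dots$ an adversary who knows the agents' deterministic algorithm chooses a connected simple graph $\mathcal G_r$ on the nodes, a port labelling (at each node $v$ the incident edges get distinct local numbers $0,\dots,\deg_r(v)-1$), and a set of at most $p$ agents that are inactive in this round, where $p \ge 1$; every agent has to be active in infinitely many rounds. An active agent at $v$ sees, under $\ell_v$-hop visibility, the port-labelled subgraph induced by the nodes at distance at most $\ell_v$ from $v$, the number of ports at each of these nodes, and the identifiers of the agents at each of these nodes (but not whether these are active, nor their memory); under $\ell_c$-hop communication it exchanges its memory and its view with the active agents at distance at most $\ell_c$; it then updates its memory, which is unbounded, and stays or leaves through a port of its choice. Here $\ell_v,\ell_c\in\{0,1,2,\dots\}\cup\{\infty\}$, where $\ell_c=0$ is face-to-face and $\ell_c=\infty$ is global communication. Exploration is \emph{solvable} with $k$ agents and given $n,p,\ell_v,\ell_c$ if some algorithm guarantees, for all initial positions of the agents and all choices of the adversary, that every node is visited by an agent in some round. (The algorithm may know $n$, $k$, $p$, and the nodes may have visible unique names.) (i) Exploration with $(n-2)(p+1)+1$ agents requires both $1$-hop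 visibility and $1$-hop communication in the following sense: it is not solvable with $\ell_v=0$, for any $\ell_c$; and, for $n\ge 9$, it is not solvable with $\ell_v\le 1$ and $\ell_c=0$. (ii) Consequently, if exploration is solvable with $k$ agents, for some $\ell_v$ and $\ell_c$, then $k\ge (p+1)(n-2)+1$, i.e. $p\le \left\lfloor\frac{k-1}{n-2}\right\rfloor-1$. (iii) This bound equals the bound $p\le\left\lceil\frac{k}{n-2}\right\rceil-2$ that expresses the impossibility of exploration for $p \ge \left\lceil\frac{k}{n-2}\right\rceil-1$: for every $k \ge 0$, $\left\lfloor\frac{k-1}{n-2}\right\rfloor-1=\left\lceil\frac{k}{n-2}\right\rceil-2$. -/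

import Mathlib

namespace DynExplore

/-- The graph of one round on the node set `V`: a connected simple graph in which the edges
incident to each node `v` carry distinct local port numbers `0, …, deg v - 1`; `port v w` is the
number at `v` of the edge `{v, w}` (its value is irrelevant when `v` and `w` are not adjacent). -/
structure Snapshot (V : Type) where
  graph : SimpleGraph V
  connected : graph.Connected
  port : V → V → ℕ
  port_bijOn : ∀ v, Set.BijOn (port v) (graph.neighborSet v) (Set.Iio (graph.neighborSet v).ncard)

open Classical in
/-- The node reached from `v` by an action: `none` means staying, `some q` means leaving through
port `q` (an agent that names a port that does not exist stays). -/
noncomputable def Snapshot.target {V : Type} (G : Snapshot V) (v : V) : Option ℕ → V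
  | none => v
  | some q => if h : ∃ w, G.graph.Adj v w ∧ G.port v w = q then h.choose else v

/-- What an agent can see in one round: the node where it is, the nodes in its range, the
port-labelled subgraph induced by them (`(u, w, q)` stands for the edge `{u, w}` with port `q` at
`u`), the number of ports at each of these nodes, and the identifiers of the agents at each of
them. It shows neither the memory of an agent nor whether an agent is active. -/
@[ext]
structure View (V A : Type) where
  here : V
  nodes : Set V
  edges : Set (V × V × ℕ)
  degrees : Set (V × ℕ)
  agents : Set (V × A)

/-- The view from `v` under `ℓ`-hop visibility, the agents being placed according to `pos`. -/
noncomputable def Snapshot.view {V A : Type} (G : Snapshot V) (ℓ : ℕ∞) (pos : A → V) (v : V) :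
    View V A where
  here := v
  nodes := {u | G.graph.edist v u ≤ ℓ}
  edges := {e | G.graph.edist v e.1 ≤ ℓ ∧ G.graph.edist v e.2.1 ≤ ℓ ∧
    G.graph.Adj e.1 e.2.1 ∧ G.port e.1 e.2.1 = e.2.2}
  degrees := {e | G.graph.edist v e.1 ≤ ℓ ∧ (G.graph.neighborSet e.1).ncard = e.2}
  agents := {e | G.graph.edist v e.1 ≤ ℓ ∧ pos e.2 = e.1}

/-- A deterministic algorithm for the agents. The elements of `A` are the (unique) identifiers of
the agents. Memory is unbounded. From its identifier, its memory, its view and the messages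
received in the round (`none` from an agent from which nothing was received; a message consists of
the memory and the view of the sender) an active agent computes its new memory and its action.

As `V` and `A` are known to the algorithm and nodes can be recognized, this class contains all
algorithms for anonymous nodes and for agents without knowledge of `n` and `k`. -/
structure Algorithm (V A : Type) where
  State : Type
  init : A → State
  step : A → State → View V A → (A → Option (State × View V A)) → State × Option ℕ

/-- The choices of the adversary: the graph, the port labels and the set of active agents in every
round. Since algorithms are deterministic, an adversary who knows the algorithm and reacts to the
agents can do no more than to fix these choices in advance. -/
structure Schedule (V A : Type) where
  snapshot : ℕ → Snapshot V
  active : ℕ → Set A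

/-- At most `p` agents are inactive in each round, and every agent is active infinitely often. -/
def Schedule.Admissible {V A : Type} (S : Schedule V A) (p : ℕ) : Prop :=
  (∀ r, (S.active r)ᶜ.encard ≤ p) ∧ ∀ a r, ∃ r', r ≤ r' ∧ a ∈ S.active r'

/-- A configuration: the position and the memory of every agent. -/
structure Config {V A : Type} (alg : Algorithm V A) where
  pos : A → V
  mem : A → alg.State

open Classical in
/-- The messages that an agent at node `v` receives under `ℓc`-hop communication: those of the
active agents within `ℓc` hops of `v`. -/
noncomputable def received {V A : Type} (alg : Algorithm V A) (ℓv ℓc : ℕ∞) (G : Snapshot V)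
    (active : Set A) (c : Config alg) (v : V) : A → Option (alg.State × View V A) :=
  fun b => if b ∈ active ∧ G.graph.edist v (c.pos b) ≤ ℓc then
    some (c.mem b, G.view ℓv c.pos (c.pos b)) else none

/-- The new memory and the action computed by an agent `a`, if it is active. -/
noncomputable def decision {V A : Type} (alg : Algorithm V A) (ℓv ℓc : ℕ∞) (G : Snapshot V)
    (active : Set A) (c : Config alg) (a : A) : alg.State × Option ℕ :=
  alg.step a (c.mem a) (G.view ℓv c.pos (c.pos a)) (received alg ℓv ℓc G active c (c.pos a))

open Classical in
/-- One round: every active agent communicates, computes and moves; the others do nothing. -/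
noncomputable def nextConfig {V A : Type} (alg : Algorithm V A) (ℓv ℓc : ℕ∞) (G : Snapshot V)
    (active : Set A) (c : Config alg) : Config alg where
  pos a := if a ∈ active then G.target (c.pos a) (decision alg ℓv ℓc G active c a).2 else c.pos a
  mem a := if a ∈ active then (decision alg ℓv ℓc G active c a).1 else c.mem a

/-- The configuration at the beginning of each round, for initial positions `pos₀`. -/
noncomputable def run {V A : Type} (alg : Algorithm V A) (ℓv ℓc : ℕ∞) (S : Schedule V A)
    (pos₀ : A → V) : ℕ → Config alg
  | 0 => ⟨pos₀, alg.init⟩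
  | r + 1 => nextConfig alg ℓv ℓc (S.snapshot r) (S.active r) (run alg ℓv ℓc S pos₀ r)

/-- Exploration: every node is visited in some round. -/
def Explores {V A : Type} (alg : Algorithm V A) (ℓv ℓc : ℕ∞) (S : Schedule V A)
    (pos₀ : A → V) : Prop :=
  ∀ v, ∃ r a, (run alg ℓv ℓc S pos₀ r).pos a = v

/-- Exploration of 1-interval connected dynamic graphs on `n` nodes is solvable with `k` agents that
have `ℓv`-hop visibility and `ℓc`-hop communication against an adversary that deactivates at most
`p` agents per round: some algorithm explores from all initial positions under all admissible
schedules. `ℓv = ⊤` is full visibility, `ℓc = 0` is face-to-face communication and `ℓc = ⊤` is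
global communication. -/
def Solvable (n k p : ℕ) (ℓv ℓc : ℕ∞) : Prop :=
  ∃ alg : Algorithm (Fin n) (Fin k), ∀ (pos₀ : Fin k → Fin n) (S : Schedule (Fin n) (Fin k)),
    S.Admissible p → Explores alg ℓv ℓc S pos₀

end DynExplore

namespace DynExplore

/-! The adversary keeps one node `t` empty forever. If the agents at `w ≠ t` are inactive and `w` is
the only neighbour of `t`, nobody enters `t`. So `w` must hold at most `p` agents. For fairness it
must also differ from the node `v` frozen in the previous round, unless it is empty
(`exists_schedule_not_explores`).

With a star centred at `w`, this fails only if every node except `t` and `v` holds at least `p + 1`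
agents. Then at most `k - (n - 2) (p + 1)` agents are at `v`. If that number is `0`, the star at `v`
works with everybody active. If it is `1`, the lone agent at `v` cannot tell the ports apart without
visibility, and a relabelling sends it elsewhere (`exists_starSnapshot_pos_ne`).

With 1-hop visibility and face-to-face communication the adversary avoids the bad case, in which one
node holds `1` agent and all others except `t` hold `p + 1`, by keeping the configuration
`Unbalanced`. It uses a path starting with `t`, `w` and possibly one more node. An agent well inside
the path acts only on its two neighbours, so the remaining nodes can be thought of as a cycle, to be
cut open far from any prescribed node `z`; the next count at `z` is then the one on the cycle
(`exists_rotated_path`). The cycle preserves the number of agents, and that number is not a sum of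
terms `1` and `p + 1`, so some `z` gets another count (`exists_unbalanced`). -/

/-! ### From an invariant to a fair schedule -/

/-- An adversary that can maintain an invariant under which the node `t` is unoccupied, such that
the inactive agents of each round are at one node and active in the next round, prevents
exploration. -/
theorem exists_schedule_not_explores {V A : Type} (alg : Algorithm V A) (ℓv ℓc : ℕ∞) (p : ℕ)
    (t : V) (Inv : Config alg → Prop) (pos₀ : A → V) (h₀ : Inv ⟨pos₀, alg.init⟩)
    (hInv : ∀ c, Inv c → ∀ a, c.pos a ≠ t)
    (hstep : ∀ c, Inv c → ∀ v, ∃ (G : Snapshot V) (act : Set A) (w : V), actᶜ.encard ≤ p ∧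
      (∀ a ∉ act, c.pos a = w ∧ c.pos a ≠ v) ∧ Inv (nextConfig alg ℓv ℓc G act c)) :
    ∃ S : Schedule V A, S.Admissible p ∧ ¬ Explores alg ℓv ℓc S pos₀ := by
  choose G act w hcard hact hnext using hstep
  -- The second component is the node whose agents were inactive in the previous round; the initial
  -- value `t` is harmless because `t` is unoccupied.
  let st : ℕ → {c : Config alg // Inv c} × V := fun r => Nat.rec (⟨⟨pos₀, alg.init⟩, h₀⟩, t)
    (fun _ s => (⟨_, hnext s.1.1 s.1.2 s.2⟩, w s.1.1 s.1.2 s.2)) r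
  let S : Schedule V A := ⟨fun r => G (st r).1.1 (st r).1.2 (st r).2,
    fun r => act (st r).1.1 (st r).1.2 (st r).2⟩
  have hrun : ∀ r, run alg ℓv ℓc S pos₀ r = (st r).1.1 := by
    intro r
    induction r with
    | zero => rfl
    | succ r ih => rw [run, ih]
  refine ⟨S, ⟨fun r => hcard _ _ _, fun a r => ?_⟩, fun hexp => ?_⟩
  · by_cases ha : a ∈ S.active r
    · exact ⟨r, le_rfl, ha⟩
    -- An inactive agent stays at the frozen node, where no agent may be inactive in the following
    -- round.
    · refine ⟨r + 1, r.le_succ, ?_⟩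
      by_contra hb
      have h1 := (hact _ _ _ a ha).1
      have h2 := (hact _ _ _ a hb).2
      have h3 : (nextConfig alg ℓv ℓc (S.snapshot r) (S.active r) (st r).1.1).pos a =
          (st r).1.1.pos a := by simp [nextConfig, ha]
      exact h2 (h3.trans h1)
  · obtain ⟨r, a, h⟩ := hexp t
    rw [hrun] at h
    exact hInv _ (st r).1.2 a h

/-! ### Moves and port labels -/

theorem Snapshot.target_eq_or_adj {V : Type} (G : Snapshot V) (v : V) (o : Option ℕ) :
    G.target v o = v ∨ G.graph.Adj v (G.target v o) := by
  cases o with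
  | none => exact Or.inl rfl
  | some q =>
    by_cases h : ∃ w, G.graph.Adj v w ∧ G.port v w = q
    · right
      simp only [Snapshot.target, h, dif_pos]
      exact h.choose_spec.1
    · left
      simp only [Snapshot.target, h, dif_neg, not_false_eq_true]

theorem Snapshot.target_some_of_port {V : Type} (G : Snapshot V) {v w : V}
    (hw : G.graph.Adj v w) : G.target v (some (G.port v w)) = w := by
  have h : ∃ u, G.graph.Adj v u ∧ G.port v u = G.port v w := ⟨w, hw, rfl⟩
  simp only [Snapshot.target, h, dif_pos]
  exact (G.port_bijOn v).injOn h.choose_spec.1 hw h.choose_spec.2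

theorem Snapshot.target_some_of_ne {V : Type} (G : Snapshot V) {v : V} {q : ℕ}
    (hq : ∀ w, G.graph.Adj v w → G.port v w ≠ q) : G.target v (some q) = v := by
  have h : ¬ ∃ u, G.graph.Adj v u ∧ G.port v u = q := fun ⟨u, h1, h2⟩ => hq u h1 h2
  simp only [Snapshot.target, h, dif_neg, not_false_eq_true]

theorem Snapshot.port_target {V : Type} (G : Snapshot V) {v : V} {o : Option ℕ}
    (h : G.target v o ≠ v) : o = some (G.port v (G.target v o)) := by
  cases o with
  | none => exact absurd rfl h
  | some q =>
    by_cases hq : ∃ w, G.graph.Adj v w ∧ G.port v w = q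
    · obtain ⟨w, hw, rfl⟩ := hq
      rw [G.target_some_of_port hw]
    · exact absurd (G.target_some_of_ne fun w h1 h2 => hq ⟨w, h1, h2⟩) h

theorem nextConfig_pos_eq_or_adj {V A : Type} (alg : Algorithm V A) (ℓv ℓc : ℕ∞)
    (G : Snapshot V) (act : Set A) (c : Config alg) (a : A) :
    (nextConfig alg ℓv ℓc G act c).pos a = c.pos a ∨
      G.graph.Adj (c.pos a) ((nextConfig alg ℓv ℓc G act c).pos a) := by
  by_cases ha : a ∈ act
  · simp only [nextConfig, ha, if_true]
    exact G.target_eq_or_adj _ _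
  · simp [nextConfig, ha]

theorem bijOn_Iio_ncard {V : Type} [Finite V] {S : Set V} {f : V → ℕ} (hinj : Set.InjOn f S)
    (hlt : ∀ v ∈ S, f v < S.ncard) : Set.BijOn f S (Set.Iio S.ncard) := by
  refine ⟨hlt, hinj, ?_⟩
  have h : f '' S = Set.Iio S.ncard := by
    refine Set.eq_of_subset_of_ncard_le (Set.image_subset_iff.2 hlt) ?_ (Set.finite_Iio _)
    rw [hinj.ncard_image, ← Finset.coe_Iio, Set.ncard_coe_finset, Nat.card_Iio]
  exact h.ge

/-! ### Stars, and agents without visibility -/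

/-- The star with centre `w`, whose edges are numbered at `w` according to `e`. -/
def starSnapshot {n : ℕ} (w : Fin n) (e : Fin n ≃ Fin n) (he : ∀ v, e v ≤ e w) :
    Snapshot (Fin n) where
  graph := SimpleGraph.starGraph w
  connected := SimpleGraph.connected_starGraph w
  port v u := if v = w then e u else 0
  port_bijOn v := by
    by_cases hv : v = w
    · subst hv
      have hS : (SimpleGraph.starGraph v).neighborSet v = {v}ᶜ := by
        ext u
        simp [eq_comm]
      have hcard : ((SimpleGraph.starGraph v).neighborSet v).ncard = n - 1 := by
        rw [hS, Set.ncard_compl, Set.ncard_singleton, Nat.card_eq_fintype_card, Fintype.card_fin]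
      apply bijOn_Iio_ncard
      · intro u _ u' _ h
        simpa [Fin.val_inj] using h
      · intro u hu
        rw [hcard, if_pos rfl]
        have h1 := he u
        have h2 : e u ≠ e v := fun h => by simp [e.injective h] at hu
        have h3 := (e v).isLt
        have h4 : (e u).val < (e v).val := lt_of_le_of_ne h1 (Fin.val_ne_of_ne h2)
        omega
    · have hS : (SimpleGraph.starGraph w).neighborSet v = {w} := by
        ext u
        simp only [SimpleGraph.mem_neighborSet, SimpleGraph.starGraph_adj,
          Set.mem_singleton_iff]
        grind
      rw [hS]
      apply bijOn_Iio_ncard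
      · simp
      · simp [hv]

/-- Giving the centre the largest value leaves `0, …, n - 2` for the leaves, exactly the port
numbers needed at the centre. -/
theorem exists_equiv_max {n : ℕ} (w : Fin n) : ∃ e : Fin n ≃ Fin n, ∀ v, e v ≤ e w := by
  cases n with
  | zero => exact w.elim0
  | succ n => exact ⟨Equiv.swap w (Fin.last n), fun v => by simp [Fin.le_last]⟩

theorem starSnapshot_adj {n : ℕ} {w : Fin n} {e : Fin n ≃ Fin n} {he : ∀ v, e v ≤ e w}
    {u v : Fin n} :
    (starSnapshot w e he).graph.Adj u v ↔ u ≠ v ∧ (u = w ∨ v = w) :=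
  SimpleGraph.starGraph_adj

/-- In a star with centre `w`, only agents at `w` can enter another node. -/
theorem nextConfig_starSnapshot_pos_ne {n : ℕ} {A : Type} {alg : Algorithm (Fin n) A} {ℓv ℓc : ℕ∞}
    {w : Fin n} {e : Fin n ≃ Fin n} {he : ∀ v, e v ≤ e w} {act : Set A} {c : Config alg}
    {t : Fin n} (htw : t ≠ w) {a : A} (hat : c.pos a ≠ t) (haw : a ∈ act → c.pos a ≠ w) :
    (nextConfig alg ℓv ℓc (starSnapshot w e he) act c).pos a ≠ t := by
  intro h
  by_cases ha : a ∈ act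
  · rcases nextConfig_pos_eq_or_adj alg ℓv ℓc (starSnapshot w e he) act c a with h1 | h1
    · exact hat (h1 ▸ h)
    · rw [h, starSnapshot_adj] at h1
      exact h1.2.elim (haw ha) htw
  · simp only [nextConfig, ha, if_false] at h
    exact hat h

/-- Without visibility, a view does not show the port labels. -/
theorem Snapshot.view_zero_congr {V A : Type} {G G' : Snapshot V} (h : G.graph = G'.graph)
    (pos : A → V) (v : V) : G.view 0 pos v = G'.view 0 pos v := by
  ext x
  · rfl
  · simp [Snapshot.view, h]
  · simp only [Snapshot.view, h, nonpos_iff_eq_zero, SimpleGraph.edist_eq_zero_iff,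
      Set.mem_ofPred_eq]
    constructor <;> rintro ⟨h1, h2, h3, -⟩ <;> exact absurd (h1.symm.trans h2) h3.ne
  · simp [Snapshot.view, h]
  · simp [Snapshot.view, h]

/-- Messages contain only memories and views, and the views show no port labels, so no range of
communication helps. -/
theorem decision_zero_congr {V A : Type} (alg : Algorithm V A) (ℓc : ℕ∞) {G G' : Snapshot V}
    (h : G.graph = G'.graph) (act : Set A) (c : Config alg) (a : A) :
    decision alg 0 ℓc G act c a = decision alg 0 ℓc G' act c a := by
  have hr : received alg 0 ℓc G act c = received alg 0 ℓc G' act c := by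
    funext v b
    simp only [received, Snapshot.view_zero_congr h]
    rw [h]
  simp only [decision, Snapshot.view_zero_congr h, hr]

/-- Without visibility, the star at a node with at most one agent can be labelled such that no
agent enters a given node. -/
theorem exists_starSnapshot_pos_ne {n : ℕ} (hn : 3 ≤ n) {A : Type} {alg : Algorithm (Fin n) A}
    {ℓc : ℕ∞} {w t : Fin n} (htw : t ≠ w) {act : Set A} {c : Config alg}
    (hw : {a | c.pos a = w}.Subsingleton) (hat : ∀ a, c.pos a ≠ t) :
    ∃ G : Snapshot (Fin n), ∀ a, (nextConfig alg 0 ℓc G act c).pos a ≠ t := by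
  obtain ⟨e, he⟩ := exists_equiv_max w
  by_cases hG : ∀ a, (nextConfig alg 0 ℓc (starSnapshot w e he) act c).pos a ≠ t
  · exact ⟨_, hG⟩
  push Not at hG
  obtain ⟨a, ha⟩ := hG
  have haw : a ∈ act ∧ c.pos a = w := by
    by_contra hcon
    exact nextConfig_starSnapshot_pos_ne htw (hat a) (fun h h' => hcon ⟨h, h'⟩) ha
  obtain ⟨u, hu⟩ : ∃ u : Fin n, u ∉ ({t, w} : Finset (Fin n)) := by
    by_contra! hcon
    have h1 := Finset.card_le_card (fun x _ => hcon x : Finset.univ ⊆ ({t, w} : Finset (Fin n)))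
    have h2 := Finset.card_le_two (a := t) (b := w)
    rw [Finset.card_univ, Fintype.card_fin] at h1
    omega
  simp only [Finset.mem_insert, Finset.mem_singleton, not_or] at hu
  -- Exchanging the ports of `t` and `u` does not change the decision of the only agent at `w`,
  -- which names the old port of `t`; this port now leads to `u`.
  have hsw : Equiv.swap t u w = w := Equiv.swap_apply_of_ne_of_ne htw.symm (Ne.symm hu.2)
  have he' : ∀ v, ((Equiv.swap t u).trans e) v ≤ ((Equiv.swap t u).trans e) w := fun v => by
    simpa [hsw] using he _
  refine ⟨starSnapshot w _ he', fun b hb => ?_⟩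
  have hbw : b ∈ act ∧ c.pos b = w := by
    by_contra hcon
    exact nextConfig_starSnapshot_pos_ne htw (hat b) (fun h h' => hcon ⟨h, h'⟩) hb
  obtain rfl : b = a := hw hbw.2 haw.2
  simp only [nextConfig, haw.1, if_true, haw.2] at ha hb
  rw [decision_zero_congr alg ℓc (G := starSnapshot w _ he') (G' := starSnapshot w e he) rfl]
    at hb
  have h1 := Snapshot.port_target (G := starSnapshot w e he) (ha ▸ htw)
  have h2 := Snapshot.port_target (G := starSnapshot w _ he') (hb ▸ htw)
  rw [ha] at h1
  rw [hb] at h2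
  have h3 := Option.some.inj (h1.symm.trans h2)
  simp only [starSnapshot, if_true, Equiv.trans_apply, Equiv.swap_apply_left, Fin.val_inj] at h3
  exact hu.1 (e.injective h3).symm

/-! ### Paths and what is seen inside them -/

/-- The path on which the node `v` has the position `x v`. At every node except the first one,
port `0` leads backwards and port `1` leads forwards. -/
def pathSnapshot {V : Type} {N : ℕ} (x : V ≃ Fin (N + 1)) : Snapshot V where
  graph := (SimpleGraph.pathGraph (N + 1)).comap x
  connected := (SimpleGraph.Iso.comap x _).connected_iff.2 (SimpleGraph.pathGraph_connected N)
  port u v := if (x u).val ≠ 0 ∧ (x u).val < (x v).val then 1 else 0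
  port_bijOn u := by
    have : Finite V := Finite.of_equiv _ x.symm
    apply bijOn_Iio_ncard
    · intro v hv v' hv' h
      simp only [SimpleGraph.mem_neighborSet, SimpleGraph.comap_adj, SimpleGraph.pathGraph_adj]
        at hv hv'
      apply x.injective
      apply Fin.ext
      dsimp only at h
      split_ifs at h <;> omega
    · intro v hv
      split_ifs with h
      · rw [Set.one_lt_ncard_iff]
        simp only [SimpleGraph.mem_neighborSet, SimpleGraph.comap_adj,
          SimpleGraph.pathGraph_adj] at hv ⊢
        refine ⟨x.symm ⟨(x u).val - 1, by omega⟩, v, ?_, hv, fun hcon => ?_⟩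
        · right
          simp only [Equiv.apply_symm_apply]
          omega
        · rw [← hcon, Equiv.apply_symm_apply] at h
          dsimp only at h
          omega
      · exact (Set.ncard_pos).2 ⟨v, hv⟩

theorem pathSnapshot_adj {V : Type} {N : ℕ} {x : V ≃ Fin (N + 1)} {u v : V} :
    (pathSnapshot x).graph.Adj u v ↔ (x u).val + 1 = (x v).val ∨ (x v).val + 1 = (x u).val := by
  simp [pathSnapshot, SimpleGraph.pathGraph_adj]

theorem pathSnapshot_port {V : Type} {N : ℕ} (x : V ≃ Fin (N + 1)) (u v : V) :
    (pathSnapshot x).port u v = if (x u).val ≠ 0 ∧ (x u).val < (x v).val then 1 else 0 :=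
  rfl

theorem ncard_neighborSet_pathSnapshot {V : Type} {N : ℕ} {x : V ≃ Fin (N + 1)} {v : V}
    (h0 : 1 ≤ (x v).val) (h1 : (x v).val < N) :
    ((pathSnapshot x).graph.neighborSet v).ncard = 2 := by
  have hS : (pathSnapshot x).graph.neighborSet v =
      {x.symm ⟨(x v).val - 1, by omega⟩, x.symm ⟨(x v).val + 1, by omega⟩} := by
    ext u
    simp only [SimpleGraph.mem_neighborSet, pathSnapshot_adj, Set.mem_insert_iff,
      Set.mem_singleton_iff, Equiv.eq_symm_apply, Fin.ext_iff]
    omega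
  rw [hS, Set.ncard_pair]
  intro h
  have := Fin.ext_iff.1 (x.symm.injective h)
  dsimp only at this
  omega

/-- The view of an agent under `1`-hop visibility from the node `b` in the interior of a path on
which the preceding node is `a` and the following node is `b'`. -/
def lineView {V A : Type} (pos : A → V) (a b b' : V) : View V A where
  here := b
  nodes := {a, b, b'}
  edges := {(a, b, 1), (b, a, 0), (b, b', 1), (b', b, 0)}
  degrees := {(a, 2), (b, 2), (b', 2)}
  agents := {e | e.1 ∈ ({a, b, b'} : Set V) ∧ pos e.2 = e.1}

/-- The node reached from `b` by an action in the interior of a path. -/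
def lineTarget {V : Type} (a b b' : V) : Option ℕ → V
  | some 0 => a
  | some 1 => b'
  | _ => b

theorem lineTarget_mem {V : Type} (a b b' : V) (o : Option ℕ) :
    lineTarget a b b' o = a ∨ lineTarget a b b' o = b ∨ lineTarget a b b' o = b' := by
  unfold lineTarget
  split <;> simp

/-- `b` is an inner node of the path, its neighbours are the inner nodes `a` and `b'`. -/
structure InnerTriple {V : Type} {N : ℕ} (x : V ≃ Fin (N + 1)) (a b b' : V) : Prop where
  pos_left : 1 ≤ (x a).val
  left : (x a).val + 1 = (x b).val
  right : (x b).val + 1 = (x b').val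
  right_lt : (x b').val < N

namespace InnerTriple

variable {V A : Type} {N : ℕ} {x : V ≃ Fin (N + 1)} {a b b' : V}

theorem adj_iff (h : InnerTriple x a b b') {u : V} :
    (pathSnapshot x).graph.Adj b u ↔ u = a ∨ u = b' := by
  obtain ⟨h1, h2, h3, h4⟩ := h
  rw [pathSnapshot_adj, ← x.injective.eq_iff, ← x.injective.eq_iff (b := b'), Fin.ext_iff,
    Fin.ext_iff]
  omega

theorem edist_le_one_iff (h : InnerTriple x a b b') {u : V} :
    (pathSnapshot x).graph.edist b u ≤ 1 ↔ u = a ∨ u = b ∨ u = b' := by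
  rw [SimpleGraph.edist_le_one_iff_adj_or_eq, h.adj_iff]
  tauto

/-- The view includes the degrees of `a` and `b'` and the port at `a` towards `b`. This is why these
two must be inner nodes as well. -/
theorem view_eq (h : InnerTriple x a b b') (pos : A → V) :
    (pathSnapshot x).view 1 pos b = lineView pos a b b' := by
  have hdist := fun u => h.edist_le_one_iff (u := u)
  obtain ⟨h1, h2, h3, h4⟩ := h
  ext y
  · rfl
  · simp [Snapshot.view, lineView, hdist]
  · obtain ⟨u, v, q⟩ := y
    simp only [Snapshot.view, lineView, hdist, Set.mem_ofPred_eq, Set.mem_insert_iff,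
      Set.mem_singleton_iff, Prod.mk.injEq, pathSnapshot_adj, pathSnapshot_port]
    constructor
    · rintro ⟨rfl | rfl | rfl, rfl | rfl | rfl, h5, h6⟩ <;> split_ifs at h6 <;>
        first | omega | simp [← h6]
    · rintro (⟨rfl, rfl, rfl⟩ | ⟨rfl, rfl, rfl⟩ | ⟨rfl, rfl, rfl⟩ | ⟨rfl, rfl, rfl⟩) <;>
        refine ⟨by simp, by simp, by omega, ?_⟩ <;> split_ifs <;> omega
  · obtain ⟨u, q⟩ := y
    simp only [Snapshot.view, lineView, hdist, Set.mem_ofPred_eq, Set.mem_insert_iff,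
      Set.mem_singleton_iff, Prod.mk.injEq]
    constructor
    · rintro ⟨rfl | rfl | rfl, h5⟩ <;>
        rw [ncard_neighborSet_pathSnapshot (by omega) (by omega)] at h5 <;> simp [h5]
    · rintro (⟨rfl, rfl⟩ | ⟨rfl, rfl⟩ | ⟨rfl, rfl⟩) <;>
        exact ⟨by simp, ncard_neighborSet_pathSnapshot (by omega) (by omega)⟩
  · simp [Snapshot.view, lineView, hdist]

theorem target_eq (h : InnerTriple x a b b') (o : Option ℕ) :
    (pathSnapshot x).target b o = lineTarget a b b' o := by
  have ha : (pathSnapshot x).graph.Adj b a := h.adj_iff.2 (Or.inl rfl)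
  have hb : (pathSnapshot x).graph.Adj b b' := h.adj_iff.2 (Or.inr rfl)
  have pa : (pathSnapshot x).port b a = 0 := by
    rw [pathSnapshot_port, if_neg]
    have := h.left
    omega
  have pb : (pathSnapshot x).port b b' = 1 := by
    rw [pathSnapshot_port, if_pos]
    have := h.left
    have := h.right
    omega
  match o with
  | none => rfl
  | some 0 => simpa only [pa] using! Snapshot.target_some_of_port _ ha
  | some 1 => simpa only [pb] using! Snapshot.target_some_of_port _ hb
  | some (q + 2) =>
    apply Snapshot.target_some_of_ne
    intro u hu
    rcases h.adj_iff.1 hu with rfl | rfl <;> omega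

end InnerTriple

open Classical in
/-- The next position of an active agent `i` with `1`-hop visibility and face-to-face
communication at the node `b` in the interior of a path. -/
noncomputable def lineMove {V A : Type} (alg : Algorithm V A) (act : Set A) (c : Config alg)
    (a b b' : V) (i : A) : V :=
  lineTarget a b b' (alg.step i (c.mem i) (lineView c.pos a b b') fun j =>
    if j ∈ act ∧ b = c.pos j then some (c.mem j, lineView c.pos a b b') else none).2

/-- Face-to-face messages come from the same node, so they carry the same view and reveal nothing
beyond `a`, `b` and `b'`. -/
theorem InnerTriple.nextConfig_pos {V A : Type} {N : ℕ} {x : V ≃ Fin (N + 1)} {a b b' : V}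
    (h : InnerTriple x a b b') (alg : Algorithm V A) {act : Set A} {c : Config alg} {i : A}
    (hi : i ∈ act) (hb : c.pos i = b) :
    (nextConfig alg 1 0 (pathSnapshot x) act c).pos i = lineMove alg act c a b b' i := by
  have hr : received alg 1 0 (pathSnapshot x) act c b = fun j =>
      open Classical in
      if j ∈ act ∧ b = c.pos j then some (c.mem j, lineView c.pos a b b') else none := by
    funext j
    have hd : (pathSnapshot x).graph.edist b (c.pos j) ≤ 0 ↔ b = c.pos j := by
      rw [nonpos_iff_eq_zero, SimpleGraph.edist_eq_zero_iff]
    by_cases hj : j ∈ act ∧ b = c.pos j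
    · rw [received, if_pos hj, if_pos (by rwa [hd]), ← hj.2, h.view_eq]
    · rw [received, if_neg hj, if_neg (by rwa [hd])]
  simp only [nextConfig, hi, if_true, decision, hb, h.view_eq, hr, h.target_eq, lineMove]

/-! ### Cutting a cycle open far from a given node -/

/-- The positions on a path that begins with the nodes `g (inl i)`, after which the nodes
`g (inr z)` follow in cyclic order in such a way that `g (inr z₀)` is the third of them. -/
def rotatedOrder {V : Type} {h m : ℕ} (g : Fin (h + 2) ⊕ ZMod (m + 6) ≃ V) (z₀ : ZMod (m + 6)) :
    V ≃ Fin (h + 2 + m + 5 + 1) :=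
  (g.symm.trans (Equiv.sumCongr (Equiv.refl _) (Equiv.addRight (2 - z₀)))).trans
    (finSumFinEquiv (m := h + 2) (n := m + 6))

section RotatedOrder

variable {V : Type} {h m : ℕ} (g : Fin (h + 2) ⊕ ZMod (m + 6) ≃ V) (z₀ : ZMod (m + 6))

theorem rotatedOrder_inl (i : Fin (h + 2)) : (rotatedOrder g z₀ (g (Sum.inl i))).val = i.val := by
  change (finSumFinEquiv (m := h + 2) (n := m + 6)
    (Sum.map id (fun y : ZMod (m + 6) => (y + (2 - z₀) : ZMod (m + 6)))
      (g.symm (g (Sum.inl i))))).val = _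
  rw [Equiv.symm_apply_apply]
  rfl

theorem rotatedOrder_inr (z : ZMod (m + 6)) :
    (rotatedOrder g z₀ (g (Sum.inr z))).val = h + 2 + (z + (2 - z₀)).val := by
  change (finSumFinEquiv (m := h + 2) (n := m + 6)
    (Sum.map id (fun y : ZMod (m + 6) => (y + (2 - z₀) : ZMod (m + 6)))
      (g.symm (g (Sum.inr z))))).val = _
  rw [Equiv.symm_apply_apply]
  rfl

theorem rotatedOrder_add {z : ZMod (m + 6)} {r : ℕ} (hr : r < m + 6) (hz : z = z₀ - 2 + r) :
    (rotatedOrder g z₀ (g (Sum.inr z))).val = h + 2 + r := by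
  rw [rotatedOrder_inr, hz, show z₀ - 2 + (r : ZMod (m + 6)) + (2 - z₀) = r by ring,
    ZMod.val_natCast_of_lt hr]

/-- The nodes from `z₀ - 2` to `z₀ + 2` take the first five places after the initial segment. A
sixth cyclic node follows, so none of the five is an end of the path. -/
theorem innerTriple_rotatedOrder {z : ZMod (m + 6)} (hz : z = z₀ - 1 ∨ z = z₀ ∨ z = z₀ + 1) :
    InnerTriple (rotatedOrder g z₀) (g (Sum.inr (z - 1))) (g (Sum.inr z))
      (g (Sum.inr (z + 1))) := by
  obtain ⟨r, hr, hz⟩ : ∃ r : ℕ, r < 3 ∧ z = z₀ - 1 + r := by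
    rcases hz with rfl | rfl | rfl
    · exact ⟨0, by omega, by simp⟩
    · exact ⟨1, by omega, by simp⟩
    · exact ⟨2, by omega, by push_cast; ring⟩
  have h1 := rotatedOrder_add g z₀ (z := z - 1) (r := r) (by omega) (by rw [hz]; ring)
  have h2 := rotatedOrder_add g z₀ (z := z) (r := r + 1) (by omega) (by rw [hz]; push_cast; ring)
  have h3 := rotatedOrder_add g z₀ (z := z + 1) (r := r + 2) (by omega)
    (by rw [hz]; push_cast; ring)
  constructor <;> omega

theorem eq_of_rotatedOrder_near {z : ZMod (m + 6)}
    (h1 : (rotatedOrder g z₀ (g (Sum.inr z₀))).val ≤ (rotatedOrder g z₀ (g (Sum.inr z))).val + 1)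
    (h2 : (rotatedOrder g z₀ (g (Sum.inr z))).val ≤ (rotatedOrder g z₀ (g (Sum.inr z₀))).val + 1) :
    z = z₀ - 1 ∨ z = z₀ ∨ z = z₀ + 1 := by
  rw [rotatedOrder_add g z₀ (z := z₀) (r := 2) (by omega) (by push_cast; ring),
    rotatedOrder_inr] at h1 h2
  have hz : z = z₀ - 2 + ((z + (2 - z₀)).val : ZMod (m + 6)) := by
    rw [ZMod.natCast_zmod_val]
    ring
  obtain h3 | h3 | h3 : (z + (2 - z₀)).val = 1 ∨ (z + (2 - z₀)).val = 2 ∨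
    (z + (2 - z₀)).val = 3 := by omega
  all_goals rw [h3] at hz; rw [hz]
  · left; push_cast; ring
  · right; left; push_cast; ring
  · right; right; push_cast; ring

end RotatedOrder

theorem sum_card_fiber {A V Z : Type} [Fintype A] [Fintype Z] [DecidableEq V] {i : Z → V}
    (hi : Function.Injective i) (f : A → V) [DecidablePred fun a => ∃ z, f a = i z] :
    ∑ z, (Finset.univ.filter fun a => f a = i z).card =
      (Finset.univ.filter fun a => ∃ z, f a = i z).card := by
  classical
  rw [← Finset.card_biUnion]
  · congr 1
    ext a
    simp
  · intro z _ z' _ hne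
    rw [Function.onFun, Finset.disjoint_filter]
    exact fun a _ h1 h2 => hne (hi (h1.symm.trans h2))

/-- The number of agents at the node `v`. -/
def Config.count {n k : ℕ} {alg : Algorithm (Fin n) (Fin k)} (c : Config alg) (v : Fin n) : ℕ :=
  (Finset.univ.filter fun a => c.pos a = v).card

/-- On a path that begins with the unoccupied node `g (inl 0)` and the node `g (inl 1)` with
inactive agents, the nodes `g (inr z)` can be ordered in such a way that the next number of agents
at one of them, whichever is chosen, is what it would be on the cycle of these nodes. -/
theorem exists_rotated_path {n k h m : ℕ} (alg : Algorithm (Fin n) (Fin k)) (c : Config alg)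
    (g : Fin (h + 2) ⊕ ZMod (m + 6) ≃ Fin n) (ht : ∀ a, c.pos a ≠ g (Sum.inl 0)) :
    ∃ F : ZMod (m + 6) → ℕ, ∑ z, F z = ∑ z, c.count (g (Sum.inr z)) ∧
      ∀ z, ∃ G : Snapshot (Fin n),
        (∀ a, (nextConfig alg 1 0 G {a | c.pos a ≠ g (Sum.inl 1)} c).pos a ≠ g (Sum.inl 0)) ∧
        (nextConfig alg 1 0 G {a | c.pos a ≠ g (Sum.inl 1)} c).count (g (Sum.inr z)) = F z := by
  classical
  set act : Set (Fin k) := {a | c.pos a ≠ g (Sum.inl 1)} with hact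
  -- `E a` is where `a` would go on the cycle; agents outside the cycle are left in place by
  -- convention.
  let E : Fin k → Fin n := fun a => match g.symm (c.pos a) with
    | Sum.inl _ => c.pos a
    | Sum.inr y => lineMove alg act c (g (Sum.inr (y - 1))) (g (Sum.inr y)) (g (Sum.inr (y + 1))) a
  have hEl : ∀ a i, c.pos a = g (Sum.inl i) → E a = g (Sum.inl i) := fun a i ha => by
    simp only [E, ha, Equiv.symm_apply_apply]
  have hEr : ∀ a y, c.pos a = g (Sum.inr y) → E a = lineMove alg act c (g (Sum.inr (y - 1)))
      (g (Sum.inr y)) (g (Sum.inr (y + 1))) a := fun a y ha => by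
    simp only [E, ha, Equiv.symm_apply_apply]
  have hEr' : ∀ a y, c.pos a = g (Sum.inr y) → E a = g (Sum.inr (y - 1)) ∨
      E a = g (Sum.inr y) ∨ E a = g (Sum.inr (y + 1)) := fun a y ha => by
    rw [hEr a y ha]
    exact lineTarget_mem _ _ _ _
  have hinj : Function.Injective fun z => g (Sum.inr z) := g.injective.comp Sum.inr_injective
  have hcases : ∀ a, (∃ i, c.pos a = g (Sum.inl i)) ∨ ∃ y, c.pos a = g (Sum.inr y) := fun a => by
    rcases hs : g.symm (c.pos a) with i | y
    · exact Or.inl ⟨i, by rw [← hs, Equiv.apply_symm_apply]⟩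
    · exact Or.inr ⟨y, by rw [← hs, Equiv.apply_symm_apply]⟩
  refine ⟨fun z => (Finset.univ.filter fun a => E a = g (Sum.inr z)).card, ?_, fun z => ?_⟩
  · simp only [Config.count]
    rw [sum_card_fiber hinj, sum_card_fiber hinj]
    congr 1
    ext a
    simp only [Finset.mem_filter, Finset.mem_univ, true_and]
    rcases hcases a with ⟨i, hi⟩ | ⟨y, hy⟩
    · simp [hEl a i hi, hi]
    · exact ⟨fun _ => ⟨y, hy⟩, fun _ => by
        rcases hEr' a y hy with h1 | h1 | h1 <;> exact ⟨_, h1⟩⟩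
  · have hnear := nextConfig_pos_eq_or_adj alg 1 0 (pathSnapshot (rotatedOrder g z)) act c
    simp only [pathSnapshot_adj] at hnear
    refine ⟨pathSnapshot (rotatedOrder g z), fun a hcon => ?_, ?_⟩
    · have h0 := rotatedOrder_inl g z 0
      have h1 := rotatedOrder_inl g z 1
      rcases hnear a with h2 | h2
      · exact ht a (h2 ▸ hcon)
      · rw [hcon, h0] at h2
        -- The second node of the path is the only neighbour of the first, and its agents are
        -- inactive.
        have h3 : c.pos a = g (Sum.inl 1) := by
          apply (rotatedOrder g z).injective
          apply Fin.ext
          rw [h1]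
          simp at h2 ⊢
          omega
        have h4 : a ∉ act := fun h => h h3
        simp only [nextConfig, h4, if_false] at hcon
        exact ht a hcon
    · rw [Config.count]
      congr 1
      ext a
      simp only [Finset.mem_filter, Finset.mem_univ, true_and]
      rcases hcases a with ⟨i, hi⟩ | ⟨y, hy⟩
      · rw [hEl a i hi]
        refine ⟨fun hcon => ?_, fun hcon => by simp at hcon⟩
        have h3 := hnear a
        rw [hcon, hi, rotatedOrder_inl,
          rotatedOrder_add g z (z := z) (r := 2) (by omega) (by push_cast; ring)] at h3
        have h4 := i.isLt
        rcases h3 with h3 | h3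
        · simp at h3
        · omega
      · by_cases hyz : y = z - 1 ∨ y = z ∨ y = z + 1
        · have ha : a ∈ act := by simp [hact, hy]
          rw [(innerTriple_rotatedOrder g z hyz).nextConfig_pos alg ha hy, hEr a y hy]
        -- Agents farther away cannot reach `z` in one round, neither on the path nor on the cycle.
        · constructor
          · intro hcon
            refine absurd (eq_of_rotatedOrder_near g z ?_ ?_) hyz <;>
            · have h3 := hnear a
              rw [hcon, hy] at h3
              rcases h3 with h3 | h3
              · rw [h3]; omega
              · omega
          · intro hcon
            refine absurd ?_ hyz
            rcases hEr' a y hy with h1 | h1 | h1 <;>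
              obtain rfl := hinj (h1.symm.trans hcon)
            · right; right; ring
            · right; left; rfl
            · left; ring

/-! ### Counting agents -/

section Count

variable {n k p : ℕ} {alg : Algorithm (Fin n) (Fin k)}

theorem sum_count (c : Config alg) : ∑ v, c.count v = k := by
  classical
  have h := sum_card_fiber (i := fun v : Fin n => v) Function.injective_id c.pos
  simp only [exists_eq', Finset.filter_true, Finset.card_univ, Fintype.card_fin] at h
  exact h

theorem count_eq_zero_iff {c : Config alg} {v : Fin n} : c.count v = 0 ↔ ∀ a, c.pos a ≠ v := by
  simp [Config.count, Finset.filter_eq_empty_iff]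

theorem encard_compl_pos_ne (c : Config alg) (w : Fin n) :
    ({a | c.pos a ≠ w}ᶜ : Set (Fin k)).encard = c.count w := by
  have h : ({a | c.pos a ≠ w}ᶜ : Set (Fin k)) =
      ((Finset.univ.filter fun a => c.pos a = w : Finset (Fin k)) : Set (Fin k)) := by
    ext a
    simp
  rw [h, Set.encard_coe_eq_coe_finsetCard, Config.count]

theorem count_add_sum_count_le (c : Config alg) {t v : Fin n} (hv : v ≠ t) :
    c.count v + ∑ w ∈ Finset.univ \ {t, v}, c.count w ≤ k := by
  have h := sum_count c
  rw [← Finset.sum_sdiff (Finset.subset_univ {t, v}), Finset.sum_pair hv.symm] at h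
  omega

theorem card_univ_sdiff_pair {t v : Fin n} (hv : v ≠ t) :
    (Finset.univ \ {t, v} : Finset (Fin n)).card = n - 2 := by
  rw [Finset.card_sdiff_of_subset (Finset.subset_univ _), Finset.card_pair hv.symm,
    Finset.card_univ, Fintype.card_fin]

/-- If, apart from `t`, only `v` can have at most `p` agents, then few agents are at `v`. -/
theorem count_add_le_of_heavy {c : Config alg} {t v : Fin n} (hk : k < (n - 1) * (p + 1))
    (h : ∀ w, w ≠ t → w ≠ v → p < c.count w) :
    v ≠ t ∧ (n - 2) * (p + 1) + c.count v ≤ k := by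
  have hv : v ≠ t := by
    -- With `v = t`, all `n - 1` other nodes would hold at least `p + 1` agents, more than there
    -- are.
    rintro rfl
    have h1 : ∑ w ∈ Finset.univ.erase v, c.count w ≤ k :=
      (Finset.sum_le_sum_of_subset (Finset.erase_subset _ _)).trans (sum_count c).le
    have h2 := Finset.card_nsmul_le_sum (Finset.univ.erase v) c.count (p + 1) fun w hw =>
      h w (Finset.ne_of_mem_erase hw) (Finset.ne_of_mem_erase hw)
    rw [Finset.card_erase_of_mem (Finset.mem_univ _), Finset.card_univ, Fintype.card_fin,
      smul_eq_mul] at h2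
    exact absurd (h2.trans h1) hk.not_ge
  refine ⟨hv, ?_⟩
  have h1 := count_add_sum_count_le c hv
  have h2 := Finset.card_nsmul_le_sum (Finset.univ \ {t, v}) c.count (p + 1) fun w hw => by
    simp only [Finset.mem_sdiff, Finset.mem_univ, Finset.mem_insert, Finset.mem_singleton,
      true_and, not_or] at hw
    exact h w hw.1 hw.2
  rw [card_univ_sdiff_pair hv, smul_eq_mul] at h2
  exact (add_comm _ _).trans_le ((Nat.add_le_add_left h2 _).trans h1)

/-- The `n - 2` remaining nodes share at most `(n - 2) (p + 1)` agents and each needs `p + 1`, so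
there is no slack. -/
theorem count_eq_of_heavy {c : Config alg} {t v : Fin n} (hv : v ≠ t)
    (hk : k ≤ (n - 2) * (p + 1) + c.count v) (h : ∀ w, w ≠ t → w ≠ v → p < c.count w)
    {u : Fin n} (hut : u ≠ t) (huv : u ≠ v) : c.count u = p + 1 := by
  by_contra hne
  have h1 := count_add_sum_count_le c hv
  have h2 : ∑ _w ∈ Finset.univ \ {t, v}, (p + 1) < ∑ w ∈ Finset.univ \ {t, v}, c.count w := by
    refine Finset.sum_lt_sum (fun w hw => ?_) ⟨u, by simp [hut, huv], ?_⟩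
    · simp only [Finset.mem_sdiff, Finset.mem_univ, Finset.mem_insert, Finset.mem_singleton,
        true_and, not_or] at hw
      exact h w hw.1 hw.2
    · have := h u hut huv
      omega
  rw [Finset.sum_const, card_univ_sdiff_pair hv, smul_eq_mul] at h2
  omega

end Count

/-! ### The star adversary -/

/-- If the star at a node with at most `p` inactive agents is always possible, except that a single
such node has to be dealt with by `hlast`, then exploration is not solvable. -/
theorem not_solvable_of_star {n k p : ℕ} {ℓv ℓc : ℕ∞} (hn : 3 ≤ n) (hp : 1 ≤ p)
    (hk : k ≤ (n - 2) * (p + 1) + 1)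
    (hlast : ∀ (alg : Algorithm (Fin n) (Fin k)) (c : Config alg) (t v : Fin n), v ≠ t →
      (∀ a, c.pos a ≠ t) → (n - 2) * (p + 1) + c.count v ≤ k →
      ∃ G : Snapshot (Fin n), ∀ a, (nextConfig alg ℓv ℓc G Set.univ c).pos a ≠ t) :
    ¬ Solvable n k p ℓv ℓc := by
  rintro ⟨alg, halg⟩
  let t : Fin n := ⟨0, by omega⟩
  let u : Fin n := ⟨1, by omega⟩
  have htu : u ≠ t := by simp [t, u]
  have hk' : k < (n - 1) * (p + 1) := by
    obtain ⟨m, rfl⟩ : ∃ m, n = m + 3 := ⟨n - 3, by omega⟩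
    simp only [show m + 3 - 2 = m + 1 by omega, show m + 3 - 1 = m + 2 by omega] at hk ⊢
    nlinarith
  suffices h : ∃ S : Schedule (Fin n) (Fin k), S.Admissible p ∧
      ¬ Explores alg ℓv ℓc S fun _ => u from h.elim fun S hS => hS.2 (halg _ S hS.1)
  refine exists_schedule_not_explores alg ℓv ℓc p t
    (fun c => ∀ a, c.pos a ≠ t) (fun _ => u) (fun _ => htu) (fun _ h => h) ?_
  intro c hc v
  by_cases hlight : ∃ w, w ≠ t ∧ w ≠ v ∧ c.count w ≤ p
  · obtain ⟨w, hwt, hwv, hw⟩ := hlight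
    obtain ⟨e, he⟩ := exists_equiv_max w
    refine ⟨starSnapshot w e he, {a | c.pos a ≠ w}, w, ?_, fun a ha => ?_, fun a => ?_⟩
    · rw [encard_compl_pos_ne]
      exact_mod_cast hw
    · have ha' : c.pos a = w := by simpa using ha
      exact ⟨ha', ha' ▸ hwv⟩
    · exact nextConfig_starSnapshot_pos_ne hwt.symm (hc a) fun h => h
  -- Only the previously frozen node `v` can be light. Now everybody is active, so fairness imposes
  -- nothing.
  · push Not at hlight
    obtain ⟨hv, hcount⟩ := count_add_le_of_heavy hk' hlight
    obtain ⟨G, hG⟩ := hlast alg c t v hv hc hcount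
    exact ⟨G, Set.univ, v, by simp, by simp, hG⟩

/-- Fewer than `(n - 2) (p + 1) + 1` agents cannot explore. -/
theorem not_solvable_of_card_le {n k p : ℕ} (hn : 3 ≤ n) (hp : 1 ≤ p) (hk : k ≤ (n - 2) * (p + 1))
    (ℓv ℓc : ℕ∞) : ¬ Solvable n k p ℓv ℓc := by
  refine not_solvable_of_star hn hp (by omega) fun alg c t v hv hc hcount => ?_
  obtain ⟨e, he⟩ := exists_equiv_max v
  have h0 : c.count v = 0 := by omega
  rw [count_eq_zero_iff] at h0
  exact ⟨starSnapshot v e he, fun a =>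
    nextConfig_starSnapshot_pos_ne hv.symm (hc a) fun _ => h0 a⟩

/-- Without visibility, `(n - 2) (p + 1) + 1` agents cannot explore. -/
theorem not_solvable_zero_visibility {n p : ℕ} (hn : 3 ≤ n) (hp : 1 ≤ p) (ℓc : ℕ∞) :
    ¬ Solvable n ((n - 2) * (p + 1) + 1) p 0 ℓc := by
  refine not_solvable_of_star hn hp le_rfl fun alg c t v hv hc hcount => ?_
  refine exists_starSnapshot_pos_ne hn hv.symm ?_ hc
  have h1 : c.count v ≤ 1 := by omega
  rw [Config.count, Finset.card_le_one] at h1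
  exact fun a ha b hb => h1 a (by simpa using ha) b (by simpa using hb)

/-! ### Keeping the configuration unbalanced -/

/-- The node `t` is unoccupied, and the other nodes do not all have `1` or `p + 1` agents. -/
def Unbalanced {n k : ℕ} {alg : Algorithm (Fin n) (Fin k)} (p : ℕ) (t : Fin n)
    (c : Config alg) : Prop :=
  (∀ a, c.pos a ≠ t) ∧ ∃ u, u ≠ t ∧ c.count u ≠ 1 ∧ c.count u ≠ p + 1

theorem exists_sum_add_mul_eq {Z : Type} [Fintype Z] {p : ℕ} {F : Z → ℕ}
    (hF : ∀ z, F z = 1 ∨ F z = p + 1) : ∃ s, ∑ z, F z + s * p = Fintype.card Z * (p + 1) := by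
  -- Each value `1` falls short of `p + 1` by `p`, so `s` counts these values.
  refine ⟨∑ z, if F z = 1 then 1 else 0, ?_⟩
  rw [Finset.sum_mul, ← Finset.sum_add_distrib, ← Finset.card_univ, ← smul_eq_mul,
    ← Finset.sum_const]
  refine Finset.sum_congr rfl fun z _ => ?_
  rcases hF z with h | h <;> split_ifs <;> omega

/-- If `hid 0` is unoccupied and the agents at `hid 1` are inactive, a path that begins with the
nodes `hid i` can lead to an unbalanced configuration unless the number of agents at these nodes
has an exceptional value. -/
theorem exists_unbalanced_of_hidden {n k p h m : ℕ} {alg : Algorithm (Fin n) (Fin k)}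
    {c : Config alg} (hn : n = h + 2 + (m + 6)) {hid : Fin (h + 2) → Fin n}
    (hinj : Function.Injective hid) (ht : ∀ a, c.pos a ≠ hid 0)
    (hsum : ∀ s, k + s * p ≠ (m + 6) * (p + 1) + ∑ i, c.count (hid i)) :
    ∃ G, Unbalanced p (hid 0) (nextConfig alg 1 0 G {a | c.pos a ≠ hid 1} c) := by
  obtain ⟨g, hg⟩ : ∃ g : Fin (h + 2) ⊕ ZMod (m + 6) ≃ Fin n, ∀ i, g (Sum.inl i) = hid i := by
    obtain ⟨g, hg⟩ := Set.MapsTo.exists_equiv_extend_of_card_eq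
      (α := Fin (h + 2) ⊕ ZMod (m + 6)) (t := (Finset.univ : Finset (Fin n)))
      (by simp [hn, ZMod.card]) (s := Set.range Sum.inl) (f := Sum.elim hid fun _ => hid 0)
      (by simp) (by rintro _ ⟨i, rfl⟩ _ ⟨j, rfl⟩ hij; simpa using hinj hij)
    refine ⟨g.trans (Equiv.subtypeUnivEquiv fun v => Finset.mem_univ v), fun i => ?_⟩
    exact hg _ ⟨i, rfl⟩
  obtain ⟨F, hF, hG⟩ := exists_rotated_path alg c g (by rwa [hg])
  obtain ⟨z, hz⟩ : ∃ z, F z ≠ 1 ∧ F z ≠ p + 1 := by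
    -- If all counts on the cycle were `1` or `p + 1`, their sum, `k` minus the number of hidden
    -- agents, would have the form excluded by `hsum`.
    by_contra! hcon
    obtain ⟨s, hs⟩ := exists_sum_add_mul_eq (p := p) (F := F) fun z =>
      or_iff_not_imp_left.2 (hcon z)
    have h1 := sum_count c
    rw [← Equiv.sum_comp g, Fintype.sum_sum_type] at h1
    simp only [hg] at h1
    rw [ZMod.card] at hs
    exact hsum s (by omega)
  obtain ⟨G, h1, h2⟩ := hG z
  rw [hg, hg] at h1
  rw [hg] at h2
  refine ⟨G, h1, g (Sum.inr z), ?_, ?_⟩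
  · rw [← hg, g.injective.ne_iff]
    simp
  · rwa [h2]

/-- Hiding `t` and `w` leaves `(n - 2) (p + 1) + 1 - c.count w` agents on `n - 2` nodes. As `c.count
w ≤ p`, this is a sum of terms `1` and `p + 1` only if `c.count w = 1`; in that case a second light
node is hidden too. The cycle then has `n - 3` nodes, and it needs six: hence `9 ≤ n`. -/
theorem exists_unbalanced {n p : ℕ} (hn : 9 ≤ n)
    {alg : Algorithm (Fin n) (Fin ((n - 2) * (p + 1) + 1))} {c : Config alg} {t w : Fin n}
    (hc : Unbalanced p t c) (hwt : w ≠ t) (hw : c.count w ≤ p) :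
    ∃ G, Unbalanced p t (nextConfig alg 1 0 G {a | c.pos a ≠ w} c) := by
  obtain ⟨m, rfl⟩ : ∃ m, n = m + 9 := ⟨n - 9, by omega⟩
  have ht : c.count t = 0 := count_eq_zero_iff.2 hc.1
  by_cases hw1 : c.count w = 1
  · obtain ⟨w', hwt', hww', hw'⟩ : ∃ w', w' ≠ t ∧ w' ≠ w ∧ c.count w' ≤ p := by
      by_contra! hcon
      obtain ⟨u, hut, hu1, hu⟩ := hc.2
      refine hu (count_eq_of_heavy hwt (by omega) hcon hut ?_)
      rintro rfl
      exact hu1 hw1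
    -- At most `p + 1` agents are hidden, so the cycle carries more than `p + 1` per node on
    -- average.
    refine exists_unbalanced_of_hidden (h := 1) (m := m) (by omega) (hid := ![t, w, w']) ?_
      hc.1 fun s => ?_
    · intro i j hij
      fin_cases i <;> fin_cases j <;>
        simp [hwt, hwt.symm, hwt', hwt'.symm, hww', hww'.symm] at hij ⊢
    · rw [Fin.sum_univ_three]
      simp only [Matrix.cons_val]
      have h1 : (m + 9 - 2) * (p + 1) = (m + 6) * (p + 1) + (p + 1) := by
        rw [show m + 9 - 2 = m + 6 + 1 by omega]
        ring
      omega
  · refine exists_unbalanced_of_hidden (h := 0) (m := m + 1) (by omega) (hid := ![t, w]) ?_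
      hc.1 fun s => ?_
    · intro i j hij
      fin_cases i <;> fin_cases j <;> simp [hwt, hwt.symm] at hij ⊢
    · rw [Fin.sum_univ_two]
      simp only [Matrix.cons_val]
      have h1 : (m + 9 - 2) * (p + 1) = (m + 1 + 6) * (p + 1) := by
        rw [show m + 9 - 2 = m + 1 + 6 by omega]
      rcases s with - | s
      · omega
      -- For positive `s`, equality would require `c.count w = 1 + s * p > p`.
      · rw [add_mul s]
        omega

/-- With `1`-hop visibility and face-to-face communication, `(n - 2) (p + 1) + 1` agents cannot
explore. -/
theorem not_solvable_one_visibility {n p : ℕ} (hn : 9 ≤ n) (hp : 1 ≤ p) :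
    ¬ Solvable n ((n - 2) * (p + 1) + 1) p 1 0 := by
  rintro ⟨alg, halg⟩
  let t : Fin n := ⟨0, by omega⟩
  let u : Fin n := ⟨1, by omega⟩
  have htu : u ≠ t := by simp [t, u]
  have hk : (n - 2) * (p + 1) + 1 < (n - 1) * (p + 1) := by
    obtain ⟨m, rfl⟩ : ∃ m, n = m + 2 := ⟨n - 2, by omega⟩
    simp only [show m + 2 - 2 = m by omega, show m + 2 - 1 = m + 1 by omega, add_mul m]
    omega
  suffices h : ∃ S : Schedule (Fin n) (Fin ((n - 2) * (p + 1) + 1)), S.Admissible p ∧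
      ¬ Explores alg 1 0 S fun _ => u from h.elim fun S hS => hS.2 (halg _ S hS.1)
  refine exists_schedule_not_explores alg 1 0 p t (Unbalanced p t)
    (fun _ => u) ⟨fun _ => htu, u, htu, ?_⟩ (fun _ h => h.1) ?_
  -- Initially all agents are at `u`, far more than `p + 1`.
  · have h1 : (n - 2) * (p + 1) ≥ 7 * (p + 1) := Nat.mul_le_mul_right _ (by omega)
    simp only [Config.count, Finset.filter_true, Finset.card_univ, Fintype.card_fin]
    omega
  intro c hc v
  -- Reusing the previously frozen node is fair if it is empty, since then nobody is inactive.
  obtain ⟨w, hwt, hwp, hwv⟩ : ∃ w, w ≠ t ∧ c.count w ≤ p ∧ (w = v → c.count w = 0) := by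
    by_cases hlight : ∃ w, w ≠ t ∧ w ≠ v ∧ c.count w ≤ p
    · obtain ⟨w, hwt, hwv, hw⟩ := hlight
      exact ⟨w, hwt, hw, fun h => absurd h hwv⟩
    · push Not at hlight
      obtain ⟨hv, hcount⟩ := count_add_le_of_heavy hk hlight
      -- Otherwise `v` has exactly one agent, the nodes other than `t` and `v` have exactly `p + 1`
      -- each, and the configuration is balanced.
      have h0 : c.count v = 0 := by
        by_contra h0
        obtain ⟨x, hxt, hx1, hx⟩ := hc.2
        refine hx (count_eq_of_heavy hv (by omega) hlight hxt ?_)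
        rintro rfl
        omega
      exact ⟨v, hv, by omega, fun _ => h0⟩
  obtain ⟨G, hG⟩ := exists_unbalanced hn hc hwt hwp
  refine ⟨G, {a | c.pos a ≠ w}, w, ?_, fun a ha => ?_, hG⟩
  · rw [encard_compl_pos_ne]
    exact_mod_cast hwp
  · have ha' : c.pos a = w := by simpa using ha
    exact ⟨ha', fun h => count_eq_zero_iff.1 (hwv (ha'.symm.trans h)) a ha'⟩

end DynExplore

/-! ### The main theorem and the two forms of the threshold -/

theorem mainTheorem5 (n p : ℕ) (hn : 3 ≤ n) (hp : 1 ≤ p) :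
    -- with `(n - 2) (p + 1) + 1` agents, 1-hop visibility is necessary whatever the range of
    -- communication is, and with 1-hop visibility face-to-face communication is not enough
    (∀ ℓv ℓc : ℕ∞, DynExplore.Solvable n ((n - 2) * (p + 1) + 1) p ℓv ℓc →
      1 ≤ ℓv ∧ (9 ≤ n → ℓv ≤ 1 → 1 ≤ ℓc)) ∧
    -- the number of agents and the threshold for `p`, for all ranges
    (∀ (k : ℕ) (ℓv ℓc : ℕ∞), DynExplore.Solvable n k p ℓv ℓc →
      (p + 1) * (n - 2) + 1 ≤ k ∧ (p : ℤ) ≤ ⌊((k : ℚ) - 1) / ((n : ℚ) - 2)⌋ - 1) ∧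
    -- this threshold is the one that is written with a ceiling
    (∀ k : ℕ, ⌊((k : ℚ) - 1) / ((n : ℚ) - 2)⌋ - 1 = ⌈(k : ℚ) / ((n : ℚ) - 2)⌉ - 2) := by
  obtain ⟨m, rfl⟩ : ∃ m, n = m + 2 := ⟨n - 2, by omega⟩
  have hm : (0 : ℚ) < m := by exact_mod_cast (by omega : 0 < m)
  have hcast : (((m + 2 : ℕ) : ℚ) - 2) = m := by push_cast; ring
  refine ⟨fun ℓv ℓc hsol => ?_, fun k ℓv ℓc hsol => ?_, fun k => ?_⟩
  · have hv : 1 ≤ ℓv := by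
      rw [Order.one_le_iff_ne_zero]
      rintro rfl
      exact DynExplore.not_solvable_zero_visibility hn hp ℓc hsol
    refine ⟨hv, fun hn9 hv1 => ?_⟩
    obtain rfl : ℓv = 1 := le_antisymm hv1 hv
    rw [Order.one_le_iff_ne_zero]
    rintro rfl
    exact DynExplore.not_solvable_one_visibility hn9 hp hsol
  · have hk : (p + 1) * (m + 2 - 2) + 1 ≤ k := by
      by_contra hcon
      refine DynExplore.not_solvable_of_card_le hn hp ?_ ℓv ℓc hsol
      rw [mul_comm]
      omega
    refine ⟨hk, ?_⟩
    rw [le_sub_iff_add_le, Int.le_floor, hcast, le_div_iff₀ hm]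
    have hk' : (((p + 1) * m + 1 : ℕ) : ℚ) ≤ k := by exact_mod_cast hk
    push_cast at hk' ⊢
    linarith
  · rw [hcast]
    have h : ⌈(k : ℚ) / m⌉ = ⌊((k : ℚ) - 1) / m⌋ + 1 := by
      rw [Int.ceil_eq_iff]
      have h1 := Int.floor_le (((k : ℚ) - 1) / m)
      have h2 := Int.lt_floor_add_one (((k : ℚ) - 1) / m)
      set f := ⌊((k : ℚ) - 1) / m⌋
      rw [le_div_iff₀ hm] at h1
      rw [div_lt_iff₀ hm] at h2
      push_cast
      rw [lt_div_iff₀ hm, div_le_iff₀ hm]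
      refine ⟨by linarith, ?_⟩
      -- Passing to integers turns the strict bound on `k - 1` into a weak bound on `k`.
      have h3 : ((k : ℤ) - 1 : ℤ) < (f + 1) * m := by exact_mod_cast h2
      have h4 : (k : ℤ) ≤ (f + 1) * m := by omega
      exact_mod_cast h4
    rw [h]
    ring
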